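/- Let $\Omega \subset \mathbb{R}^d$ be nonempty and compact and satisfy an interior cone condition: there are $\theta \in (0, \pi/2)$ and $r > 0$ such that for every $x \in \Omega$ there is a unit vector $\xi$ with $\{x + t y : \|y\|_2 = 1,\ \langle y, \xi\rangle \ge \cos\theta,\ 0 \le t \le r\} \subset \Omega$. Let $k : \Omega \times \Omega \to \mathbb{R}$ be a strictly positive definite kernel (symmetric, with positive definite matrices $(k(x_i,x_j))_{i,j}$ for all finite sets of pairwise distinct points) that is translational invariant, $k(x,y) = \Phi(x-y)$ for some $\Phi : \mathbb{R}^d \to \mathbb{R}$. Let $\mathcal{H}_k(\Omega)$ be its native space, i.e. the Hilbert space of functions on $\Omega$ that contains $k(\cdot,x)$ for all $x\in\Omega$ and satisfies $(f, k(\cdot,x))_{\mathcal{H}_k(\Omega)} = f(x)$ for all $f$ and $x$. Suppose that $k$ has finite smoothness $\tau > d/2$, i.e. $\mathcal{H}_k(\Omega)$ is norm equivalent to the Sobolev space $W_2^\tau(\Omega)$: a function $f : \Omega \to \mathbb{R}$ belongs to $\mathcal{H}_k(\Omega)$ if and only if it is continuous and its restriction to the interior of $\Omega$ belongs to $W_2^\tau$,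 and the two norms are equivalent. Here, with $m = \lfloor\tau\rfloor$, $s = \tau - m$ and $U$ the interior of $\Omega$, $$\|u\|_{W_2^\tau(\Omega)}^2 = \sum_{|\alpha| \le m} \|D^\alpha u\|_{L^2(U)}^2 + \sum_{|\alpha| = m} \int_U\int_U \frac{|D^\alpha u(x) - D^\alpha u(y)|^2}{\|x-y\|_2^{d+2s}}\,dx\,dy$$ with weak derivatives $D^\alpha u$, where the second sum is omitted if $s = 0$. For a finite nonempty set $X_N = \{x_1, \dots, x_N\} \subset \Omega$ let $V(X_N) = \mathrm{span}\{k(\cdot,x_1), \dots, k(\cdot,x_N)\}$, let $\Pi_{V(X_N)}$ be the orthogonal projection of $\mathcal{H}_k(\Omega)$ onto $V(X_N)$, and let $h_{X_N} = \sup_{x\in\Omega} \min_{1 \le i \le N} \|x - x_i\|_2$ be the fill distance. Then there is a constant $M > 0$ with the following property: if $\epsilon > 0$ and a finite nonempty $X_N \subset \Omega$ are such that $$\|f - \Pi_{V(X_N)}(f)\|_{L^\infty(\Omega)} \le \epsilon \, \|f\|_{\mathcal{H}_k(\Omega)} \quad \text{for all } f \in \mathcal{H}_k(\Omega),$$ then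 $$h_{X_N} \le M \, \epsilon^{1/(\tau - d/2)}.$$ -/

import Mathlib

open MeasureTheory Set

/-! ### Geometry: cones and fill distance -/

/-- The cone with vertex `x`, unit direction `ξ`, opening angle `θ` and radius `r`. -/
def coneAt {d : ℕ} (x ξ : EuclideanSpace ℝ (Fin d)) (θ r : ℝ) : Set (EuclideanSpace ℝ (Fin d)) :=
  {z | ∃ (t : ℝ) (y : EuclideanSpace ℝ (Fin d)),
    t ∈ Icc 0 r ∧ ‖y‖ = 1 ∧ Real.cos θ ≤ inner ℝ y ξ ∧ z = x + t • y}

/-- The interior cone condition: one angle and one radius serve for all points of `Ω`. -/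
def InteriorConeCondition {d : ℕ} (Ω : Set (EuclideanSpace ℝ (Fin d))) : Prop :=
  ∃ θ ∈ Ioo (0 : ℝ) (Real.pi / 2), ∃ r > (0 : ℝ), ∀ x ∈ Ω,
    ∃ ξ : EuclideanSpace ℝ (Fin d), ‖ξ‖ = 1 ∧ coneAt x ξ θ r ⊆ Ω

/-- The fill distance `sup_{x ∈ Ω} min_{y ∈ X} ‖x - y‖₂` (used for `X` nonempty and `Ω` bounded,
where the supremum and the minimum are genuine). -/
noncomputable def fillDistance {d : ℕ} (Ω : Set (EuclideanSpace ℝ (Fin d))) (X : Finset Ω) : ℝ :=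
  ⨆ x : Ω, ⨅ y : X, ‖(x : EuclideanSpace ℝ (Fin d)) - ((y : Ω) : EuclideanSpace ℝ (Fin d))‖

/-! ### The Sobolev spaces `W_2^τ(U)`, `U` open, `τ ≥ 0` real -/

/-- The classical partial derivative in the `i`-th coordinate direction. -/
noncomputable def partialDeriv {d : ℕ} (i : Fin d) (φ : EuclideanSpace ℝ (Fin d) → ℝ) :
    EuclideanSpace ℝ (Fin d) → ℝ :=
  fun x => fderiv ℝ φ x (EuclideanSpace.single i 1)

/-- The classical derivative `D^α φ = ∂_0^{α_0} ⋯ ∂_{d-1}^{α_{d-1}} φ` for a multi-index `α`. -/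
noncomputable def multiDeriv {d : ℕ} (α : Fin d → ℕ) (φ : EuclideanSpace ℝ (Fin d) → ℝ) :
    EuclideanSpace ℝ (Fin d) → ℝ :=
  (List.finRange d).foldr (fun i g => (partialDeriv i)^[α i] g) φ

/-- `v` is an `α`-th weak derivative of `u` on the open set `U`. -/
def HasWeakDeriv {d : ℕ} (U : Set (EuclideanSpace ℝ (Fin d))) (α : Fin d → ℕ)
    (u v : EuclideanSpace ℝ (Fin d) → ℝ) : Prop :=
  LocallyIntegrableOn u U volume ∧ LocallyIntegrableOn v U volume ∧
    ∀ φ : EuclideanSpace ℝ (Fin d) → ℝ, ContDiff ℝ (⊤ : ℕ∞) φ → HasCompactSupport φ →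
      tsupport φ ⊆ U →
      ∫ x in U, u x * multiDeriv α φ x = (-1) ^ (∑ i, α i) * ∫ x in U, v x * φ x

/-- The square of the Sobolev–Slobodeckij seminorm of order `s ∈ (0, 1)` on `U`:
`∫_U ∫_U |v(x) - v(y)|² / ‖x - y‖^{d + 2s} dy dx`. -/
noncomputable def slobodeckijSq {d : ℕ} (U : Set (EuclideanSpace ℝ (Fin d))) (s : ℝ)
    (v : EuclideanSpace ℝ (Fin d) → ℝ) : ENNReal :=
  ∫⁻ x in U, ∫⁻ y in U, ENNReal.ofReal (|v x - v y| ^ 2 / ‖x - y‖ ^ ((d : ℝ) + 2 * s))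

/-- The square of the `W_2^τ(U)` norm, computed from a family `D` of weak derivatives. With
`m = ⌊τ⌋` and `s = τ - m` it is the sum of `‖D^α u‖²_{L²(U)}` over `|α| ≤ m`, plus, for
non-integer `τ`, the sum of the squared Slobodeckij seminorms of order `s` of `D^α u` over
`|α| = m`. -/
noncomputable def sobolevSqOf {d : ℕ} (U : Set (EuclideanSpace ℝ (Fin d))) (τ : ℝ)
    (D : (Fin d → ℕ) → EuclideanSpace ℝ (Fin d) → ℝ) : ENNReal :=
  (∑ n ∈ Finset.range (⌊τ⌋₊ + 1), ∑ α ∈ Finset.piAntidiag (Finset.univ : Finset (Fin d)) n,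
      ∫⁻ x in U, ENNReal.ofReal (|D α x| ^ 2)) +
    open Classical in
    if τ - ⌊τ⌋₊ = 0 then 0 else
      ∑ α ∈ Finset.piAntidiag (Finset.univ : Finset (Fin d)) ⌊τ⌋₊,
        slobodeckijSq U (τ - ⌊τ⌋₊) (D α)

/-- The `W_2^τ(U)` norm of `u`, with value `∞` if `u` is not in `W_2^τ(U)`. Weak derivatives are
unique almost everywhere on `U`, so that all families `D` below give the same value; if a weak
derivative of order at most `⌊τ⌋` does not exist, the infimum is over the empty set, hence `∞`. -/
noncomputable def sobolevNorm {d : ℕ} (U : Set (EuclideanSpace ℝ (Fin d))) (τ : ℝ)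
    (u : EuclideanSpace ℝ (Fin d) → ℝ) : ENNReal :=
  (⨅ (D : (Fin d → ℕ) → EuclideanSpace ℝ (Fin d) → ℝ)
    (_ : ∀ α : Fin d → ℕ, ∑ i, α i ≤ ⌊τ⌋₊ → HasWeakDeriv U α u (D α)), sobolevSqOf U τ D)
      ^ (1 / 2 : ℝ)

/-- The `W_2^τ` norm of a function on a set `Ω`, taken on the interior of `Ω` (the values of the
extension outside `Ω` play no role). -/
noncomputable def sobolevNormOn {d : ℕ} (Ω : Set (EuclideanSpace ℝ (Fin d))) (τ : ℝ)
    (f : Ω → ℝ) : ENNReal :=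
  sobolevNorm (interior Ω) τ (Function.extend Subtype.val f 0)

/-! ### Kernels and native spaces -/

/-- A symmetric function all of whose kernel matrices on finite sets of pairwise distinct points
are positive definite. -/
def IsStrictlyPosDefKernel {Ω : Type*} (k : Ω → Ω → ℝ) : Prop :=
  (∀ x y, k x y = k y x) ∧
    ∀ X : Finset Ω, (Matrix.of fun i j : X => k i j).PosDef

/-- Translational invariance: `k(x, y) = Φ(x - y)`. -/
def IsTranslationInvariant {d : ℕ} {Ω : Set (EuclideanSpace ℝ (Fin d))} (k : Ω → Ω → ℝ) : Prop :=
  ∃ Φ : EuclideanSpace ℝ (Fin d) → ℝ, ∀ x y : Ω, k x y = Φ (x - y)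

/-- The Hilbert space `H` of functions on `Ω` is the native space of `k`: it contains every
`k(·, x)`, and `⟨f, k(·, x)⟩ = f(x)`. This determines `H` uniquely as a space of functions
with inner product. -/
def IsNativeSpace {Ω : Type*} (k : Ω → Ω → ℝ) (H : Type*) [NormedAddCommGroup H]
    [InnerProductSpace ℝ H] [RKHS ℝ H Ω ℝ] : Prop :=
  ∀ x : Ω, ∃ g : H, (∀ y, g y = k y x) ∧ ∀ f : H, inner ℝ f g = f x

/-- `V(X)`, the span of the functions `k(·, x)`, `x ∈ X`, in the native space. -/
def kernelSpan {Ω : Type*} (k : Ω → Ω → ℝ) (H : Type*) [NormedAddCommGroup H]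
    [InnerProductSpace ℝ H] [RKHS ℝ H Ω ℝ] (X : Finset Ω) : Submodule ℝ H :=
  Submodule.span ℝ {g : H | ∃ x ∈ X, ∀ y, g y = k y x}

instance kernelSpan.finiteDimensional {Ω : Type*} (k : Ω → Ω → ℝ) (H : Type*)
    [NormedAddCommGroup H] [InnerProductSpace ℝ H] [RKHS ℝ H Ω ℝ] (X : Finset Ω) :
    FiniteDimensional ℝ (kernelSpan k H X) := by
  refine FiniteDimensional.span_of_finite ℝ ?_
  refine Set.Finite.subset (Set.Finite.preimage (f := fun g : H => (g : Ω → ℝ))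
    (DFunLike.coe_injective.injOn) (X.finite_toSet.image fun x => fun y => k y x)) ?_
  rintro g ⟨x, hx, hg⟩
  exact ⟨x, hx, (funext hg).symm⟩

/-- The orthogonal projection of `f` to `V(X)`, that is, the kernel interpolant of `f` on `X`. -/
noncomputable def kernelProj {Ω : Type*} (k : Ω → Ω → ℝ) {H : Type*} [NormedAddCommGroup H]
    [InnerProductSpace ℝ H] [RKHS ℝ H Ω ℝ] (X : Finset Ω) (f : H) : H :=
  (kernelSpan k H X).starProjection f

/-- Finite smoothness `τ > d/2`: the native space `H` is norm equivalent to `W_2^τ(Ω)`. As usual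
for `τ > d/2`, the elements of `W_2^τ(Ω)` are identified with continuous functions on `Ω`. -/
structure HasFiniteSmoothness {d : ℕ} (Ω : Set (EuclideanSpace ℝ (Fin d))) (H : Type*)
    [NormedAddCommGroup H] [InnerProductSpace ℝ H] [RKHS ℝ H Ω ℝ] (τ : ℝ) : Prop where
  lt : (d : ℝ) / 2 < τ
  mem_iff : ∀ f : Ω → ℝ, (∃ g : H, (g : Ω → ℝ) = f) ↔ Continuous f ∧ sobolevNormOn Ω τ f < ⊤
  norm_equiv : ∃ c > (0 : ℝ), ∃ C > (0 : ℝ), ∀ g : H,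
    ENNReal.ofReal (c * ‖g‖) ≤ sobolevNormOn Ω τ g ∧
      sobolevNormOn Ω τ g ≤ ENNReal.ofReal (C * ‖g‖)

/-! ### Calculus of iterated partial derivatives -/

section Calculus

variable {d : ℕ}

/-! The bound comes from one badly approximated function. With h half the fill distance, some x₀ in
Ω is farther than h from every point of X. The bump ψ((x - x₀)/h) then vanishes on X, so by the
reproducing property it is orthogonal to V(X) and its projection is zero (`kernelProj_eq_zero`): the
error is the bump itself.

The bump equals 1 on a ball around x₀, which meets Ω in positive measure by the cone condition
(`InteriorConeCondition.volume_inter_ball_pos`), so its L^∞ norm is at least 1. By scaling, its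
Sobolev norm is at most C h^(d/2 - τ) (`exists_sobolevNorm_scaled_le`), and norm equivalence carries
this to the native norm. Hence 1 ≤ ε (C/c) h^(d/2 - τ), which is solved for h. The bump is smooth on
all of ℝ^d, so integrals over the interior of Ω are bounded by integrals over ℝ^d and no extension
operator is needed. -/

theorem ContDiff.partialDeriv {f : EuclideanSpace ℝ (Fin d) → ℝ} (hf : ContDiff ℝ (⊤ : ℕ∞) f)
    (i : Fin d) : ContDiff ℝ (⊤ : ℕ∞) (partialDeriv i f) :=
  (hf.fderiv_right (m := (⊤ : ℕ∞)) (by norm_cast)).clm_apply contDiff_const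

theorem tsupport_partialDeriv_subset (i : Fin d) (f : EuclideanSpace ℝ (Fin d) → ℝ) :
    tsupport (partialDeriv i f) ⊆ tsupport f :=
  tsupport_fderiv_apply_subset ℝ _

theorem contDiff_iterate_partialDeriv {f : EuclideanSpace ℝ (Fin d) → ℝ}
    (hf : ContDiff ℝ (⊤ : ℕ∞) f) (i : Fin d) (n : ℕ) :
    ContDiff ℝ (⊤ : ℕ∞) ((partialDeriv i)^[n] f) := by
  induction n with
  | zero => exact hf
  | succ n ih => rw [Function.iterate_succ_apply']; exact ih.partialDeriv i

theorem tsupport_iterate_partialDeriv_subset (i : Fin d) (n : ℕ)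
    (f : EuclideanSpace ℝ (Fin d) → ℝ) : tsupport ((partialDeriv i)^[n] f) ⊆ tsupport f := by
  induction n with
  | zero => exact subset_rfl
  | succ n ih =>
    rw [Function.iterate_succ_apply']
    exact (tsupport_partialDeriv_subset i _).trans ih

/-- The derivative `D^α f` with the partial derivatives applied in the order opposite to
`multiDeriv`. -/
noncomputable def foldPartial (α : Fin d → ℕ) (l : List (Fin d))
    (f : EuclideanSpace ℝ (Fin d) → ℝ) : EuclideanSpace ℝ (Fin d) → ℝ :=
  l.foldl (fun g i => (partialDeriv i)^[α i] g) f

theorem contDiff_foldPartial (α : Fin d → ℕ) (l : List (Fin d))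
    {f : EuclideanSpace ℝ (Fin d) → ℝ} (hf : ContDiff ℝ (⊤ : ℕ∞) f) :
    ContDiff ℝ (⊤ : ℕ∞) (foldPartial α l f) := by
  induction l generalizing f with
  | nil => exact hf
  | cons i l ih => exact ih (contDiff_iterate_partialDeriv hf i _)

theorem tsupport_foldPartial_subset (α : Fin d → ℕ) (l : List (Fin d))
    (f : EuclideanSpace ℝ (Fin d) → ℝ) : tsupport (foldPartial α l f) ⊆ tsupport f := by
  induction l generalizing f with
  | nil => exact subset_rfl
  | cons i l ih => exact (ih _).trans (tsupport_iterate_partialDeriv_subset i _ f)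

theorem contDiff_foldr_partialDeriv (α : Fin d → ℕ) (l : List (Fin d))
    {f : EuclideanSpace ℝ (Fin d) → ℝ} (hf : ContDiff ℝ (⊤ : ℕ∞) f) :
    ContDiff ℝ (⊤ : ℕ∞) (l.foldr (fun i g => (partialDeriv i)^[α i] g) f) := by
  induction l with
  | nil => exact hf
  | cons i l ih => exact contDiff_iterate_partialDeriv ih i _

theorem tsupport_foldr_partialDeriv_subset (α : Fin d → ℕ) (l : List (Fin d))
    (f : EuclideanSpace ℝ (Fin d) → ℝ) :
    tsupport (l.foldr (fun i g => (partialDeriv i)^[α i] g) f) ⊆ tsupport f := by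
  induction l with
  | nil => exact subset_rfl
  | cons i l ih => exact (tsupport_iterate_partialDeriv_subset i _ _).trans ih

/-! ### Integration by parts and weak derivatives -/

theorem hasCompactSupport_of_tsupport_subset {f g : EuclideanSpace ℝ (Fin d) → ℝ}
    (hg : HasCompactSupport g) (h : tsupport f ⊆ tsupport g) : HasCompactSupport f :=
  hg.of_isClosed_subset (isClosed_tsupport f) h

theorem integral_mul_partialDeriv {f φ : EuclideanSpace ℝ (Fin d) → ℝ}
    (hf : ContDiff ℝ (⊤ : ℕ∞) f) (hφ : ContDiff ℝ (⊤ : ℕ∞) φ) (hc : HasCompactSupport φ)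
    (i : Fin d) : ∫ x, f x * partialDeriv i φ x = -∫ x, partialDeriv i f x * φ x := by
  have hc' : HasCompactSupport (partialDeriv i φ) :=
    hasCompactSupport_of_tsupport_subset hc (tsupport_partialDeriv_subset i φ)
  refine integral_mul_fderiv_eq_neg_fderiv_mul_of_integrable ?_ ?_ ?_
    (fun x _ => (hf.differentiable (by simp)) x) (fun x _ => (hφ.differentiable (by simp)) x)
  · exact ((hf.partialDeriv i).continuous.mul hφ.continuous).integrable_of_hasCompactSupport
      hc.mul_left
  · exact (hf.continuous.mul (hφ.partialDeriv i).continuous).integrable_of_hasCompactSupport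
      hc'.mul_left
  · exact (hf.continuous.mul hφ.continuous).integrable_of_hasCompactSupport hc.mul_left

theorem integral_mul_iterate_partialDeriv {f φ : EuclideanSpace ℝ (Fin d) → ℝ}
    (hf : ContDiff ℝ (⊤ : ℕ∞) f) (hφ : ContDiff ℝ (⊤ : ℕ∞) φ) (hc : HasCompactSupport φ)
    (i : Fin d) (n : ℕ) :
    ∫ x, f x * (partialDeriv i)^[n] φ x = (-1) ^ n * ∫ x, (partialDeriv i)^[n] f x * φ x := by
  induction n generalizing f with
  | zero => simp
  | succ n ih =>
    rw [Function.iterate_succ_apply', Function.iterate_succ_apply,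
      integral_mul_partialDeriv hf (contDiff_iterate_partialDeriv hφ i n)
        (hasCompactSupport_of_tsupport_subset hc (tsupport_iterate_partialDeriv_subset i n φ)),
      ih (hf.partialDeriv i)]
    ring

/-- Integration by parts removes the outermost derivative of φ first, and this becomes the innermost
derivative of f. The right fold thus turns into a left fold, and partial derivatives never have to
be commuted. -/
theorem integral_mul_foldr_partialDeriv (α : Fin d → ℕ) (l : List (Fin d))
    {f φ : EuclideanSpace ℝ (Fin d) → ℝ}
    (hf : ContDiff ℝ (⊤ : ℕ∞) f) (hφ : ContDiff ℝ (⊤ : ℕ∞) φ) (hc : HasCompactSupport φ) :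
    ∫ x, f x * l.foldr (fun i g => (partialDeriv i)^[α i] g) φ x
      = (-1) ^ (l.map α).sum * ∫ x, foldPartial α l f x * φ x := by
  induction l generalizing f with
  | nil => simp [foldPartial]
  | cons i l ih =>
    rw [List.foldr_cons, integral_mul_iterate_partialDeriv hf (contDiff_foldr_partialDeriv α l hφ)
      (hasCompactSupport_of_tsupport_subset hc (tsupport_foldr_partialDeriv_subset α l φ)),
      ih (contDiff_iterate_partialDeriv hf i _)]
    simp only [foldPartial, List.foldl_cons, List.map_cons, List.sum_cons]
    ring

theorem setIntegral_eq_integral_of_tsupport_subset {U : Set (EuclideanSpace ℝ (Fin d))}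
    {φ ψ : EuclideanSpace ℝ (Fin d) → ℝ} (h : tsupport ψ ⊆ U) :
    ∫ x in U, φ x * ψ x = ∫ x, φ x * ψ x :=
  setIntegral_eq_integral_of_forall_compl_eq_zero fun x hx => by
    rw [image_eq_zero_of_notMem_tsupport fun hx' => hx (h hx'), mul_zero]

/-- A smooth function has its classical derivatives as weak derivatives. -/
theorem hasWeakDeriv_foldPartial {U : Set (EuclideanSpace ℝ (Fin d))} (hU : IsOpen U)
    (α : Fin d → ℕ) {u f : EuclideanSpace ℝ (Fin d) → ℝ} (hf : ContDiff ℝ (⊤ : ℕ∞) f)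
    (huf : EqOn u f U) : HasWeakDeriv U α u (foldPartial α (List.finRange d) f) := by
  refine ⟨?_, ?_, fun φ hφ hc hs => ?_⟩
  · exact (hf.continuous.locallyIntegrable.locallyIntegrableOn U).congr
      ((ae_restrict_mem hU.measurableSet).mono fun x hx => (huf hx).symm)
  · exact (contDiff_foldPartial α _ hf).continuous.locallyIntegrable.locallyIntegrableOn U
  · rw [setIntegral_congr_fun hU.measurableSet
      (g := fun x => f x * multiDeriv α φ x) fun x hx => by simp only [huf hx],
      setIntegral_eq_integral_of_tsupport_subset (ψ := multiDeriv α φ)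
        ((tsupport_foldr_partialDeriv_subset α (List.finRange d) φ).trans hs),
      setIntegral_eq_integral_of_tsupport_subset hs]
    refine (integral_mul_foldr_partialDeriv α (List.finRange d) hf hφ hc).trans ?_
    rw [← List.ofFn_eq_map, List.sum_ofFn]

/-! ### Derivatives of scaled functions -/

/-- The prefactor `c` makes the derivative a function of the same form, so that the rule can be
iterated. -/
theorem partialDeriv_scaled {ψ : EuclideanSpace ℝ (Fin d) → ℝ} (hψ : ContDiff ℝ (⊤ : ℕ∞) ψ)
    (i : Fin d) (c a : ℝ) (x₀ : EuclideanSpace ℝ (Fin d)) :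
    partialDeriv i (fun x => c * ψ (a • (x - x₀)))
      = fun x => c * a * partialDeriv i ψ (a • (x - x₀)) := by
  funext x
  have h1 : HasFDerivAt (fun x => a • (x - x₀))
      (a • ContinuousLinearMap.id ℝ (EuclideanSpace ℝ (Fin d))) x :=
    ((hasFDerivAt_id x).sub_const x₀).const_smul a
  have h2 := (((hψ.differentiable (by simp)) (a • (x - x₀))).hasFDerivAt.comp x h1).const_mul c
  have h3 := h2.fderiv
  simp only [partialDeriv, Function.comp_def] at h3 ⊢
  rw [h3]
  simp [mul_assoc]

theorem iterate_partialDeriv_scaled {ψ : EuclideanSpace ℝ (Fin d) → ℝ}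
    (hψ : ContDiff ℝ (⊤ : ℕ∞) ψ) (i : Fin d) (n : ℕ) (c a : ℝ)
    (x₀ : EuclideanSpace ℝ (Fin d)) :
    (partialDeriv i)^[n] (fun x => c * ψ (a • (x - x₀)))
      = fun x => c * a ^ n * (partialDeriv i)^[n] ψ (a • (x - x₀)) := by
  induction n with
  | zero => simp
  | succ n ih =>
    rw [Function.iterate_succ_apply', ih,
      partialDeriv_scaled (contDiff_iterate_partialDeriv hψ i n), Function.iterate_succ_apply',
      pow_succ, mul_assoc]

theorem foldPartial_scaled (α : Fin d → ℕ) (l : List (Fin d))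
    {ψ : EuclideanSpace ℝ (Fin d) → ℝ} (hψ : ContDiff ℝ (⊤ : ℕ∞) ψ) (c a : ℝ)
    (x₀ : EuclideanSpace ℝ (Fin d)) :
    foldPartial α l (fun x => c * ψ (a • (x - x₀)))
      = fun x => c * a ^ (l.map α).sum * foldPartial α l ψ (a • (x - x₀)) := by
  induction l generalizing ψ c with
  | nil => simp [foldPartial]
  | cons i l ih =>
    have := ih (contDiff_iterate_partialDeriv hψ i (α i)) (c * a ^ α i)
    rw [foldPartial, List.foldl_cons, iterate_partialDeriv_scaled hψ]
    refine this.trans ?_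
    simp only [foldPartial, List.foldl_cons, List.map_cons, List.sum_cons, pow_add, mul_assoc]

end Calculus

/-! ### Sobolev norms of scaled smooth functions -/

section ScaledBounds

variable {d : ℕ}

/-- The radial function `min(‖z‖², 1) / ‖z‖^(d + 2s)`, which controls Slobodeckij integrands. -/
noncomputable def slobodeckijProfile (d : ℕ) (s : ℝ) (z : EuclideanSpace ℝ (Fin d)) : ℝ :=
  min (‖z‖ ^ 2) 1 / ‖z‖ ^ ((d : ℝ) + 2 * s)

theorem measurable_slobodeckijProfile (s : ℝ) : Measurable (slobodeckijProfile d s) := by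
  unfold slobodeckijProfile
  fun_prop

/-- In polar coordinates the radial integrand is t^(1 - 2s) on (0, 1], integrable because s < 1, and
t^(-1 - 2s) beyond 1, integrable because s > 0. -/
theorem integrable_slobodeckijProfile [NeZero d] {s : ℝ} (hs : 0 < s) (hs1 : s < 1) :
    Integrable (slobodeckijProfile d s) := by
  have hd : 1 ≤ d := Nat.one_le_iff_ne_zero.2 (NeZero.ne d)
  have : Nontrivial (EuclideanSpace ℝ (Fin d)) :=
    Module.nontrivial_of_finrank_pos (R := ℝ) (by rw [finrank_euclideanSpace_fin]; exact hd)
  refine (integrable_fun_norm_addHaar volume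
    (f := fun t : ℝ => min (t ^ 2) 1 / t ^ ((d : ℝ) + 2 * s))).2 ?_
  rw [finrank_euclideanSpace_fin, ← Ioc_union_Ioi_eq_Ioi (zero_le_one' ℝ)]
  have hpow : ∀ t : ℝ, t ^ (d - 1) = t ^ ((d : ℝ) - 1) := fun t => by
    rw [← Real.rpow_natCast, Nat.cast_sub hd, Nat.cast_one]
  refine IntegrableOn.union ?_ ?_
  · have h := (intervalIntegrable_iff_integrableOn_Ioc_of_le zero_le_one).1
      (intervalIntegral.intervalIntegrable_rpow' (a := 0) (b := 1)
        (show -1 < 1 - 2 * s by linarith))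
    refine h.congr_fun (fun t ht => ?_) measurableSet_Ioc
    have h2 : t ^ 2 ≤ 1 := pow_le_one₀ ht.1.le ht.2
    simp only [smul_eq_mul, min_eq_left h2]
    rw [hpow t, ← Real.rpow_natCast t 2, ← mul_div_assoc, ← Real.rpow_add ht.1,
      ← Real.rpow_sub ht.1]
    congr 1
    push_cast
    ring
  · have h := integrableOn_Ioi_rpow_of_lt (show -1 - 2 * s < -1 by linarith) zero_lt_one
    refine h.congr_fun (fun t ht => ?_) measurableSet_Ioi
    have ht0 : (0 : ℝ) < t := zero_lt_one.trans ht
    have h2 : 1 ≤ t ^ 2 := one_le_pow₀ (le_of_lt ht)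
    simp only [smul_eq_mul, min_eq_right h2]
    rw [hpow t, mul_one_div, ← Real.rpow_sub ht0]
    congr 1
    ring

theorem lintegral_comp_smul_euclidean {g : EuclideanSpace ℝ (Fin d) → ENNReal}
    (hg : Measurable g) {h : ℝ} (hh : 0 < h) :
    ∫⁻ z, g (h⁻¹ • z) = ENNReal.ofReal (h ^ d) * ∫⁻ z, g z := by
  have hm : Measurable fun z : EuclideanSpace ℝ (Fin d) => h⁻¹ • z := by fun_prop
  rw [← lintegral_map hg hm, Measure.map_addHaar_smul volume (inv_ne_zero hh.ne'),
    lintegral_smul_measure, finrank_euclideanSpace_fin, inv_pow, inv_inv,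
    abs_of_pos (pow_pos hh d), smul_eq_mul]

theorem volume_closedBall_euclidean (x : EuclideanSpace ℝ (Fin d)) {h : ℝ} (hh : 0 ≤ h) :
    volume (Metric.closedBall x h)
      = ENNReal.ofReal (h ^ d) * volume (Metric.ball (0 : EuclideanSpace ℝ (Fin d)) 1) := by
  rw [Measure.addHaar_closedBall volume x hh, finrank_euclideanSpace_fin]

theorem eq_zero_of_notMem_closedBall {w : EuclideanSpace ℝ (Fin d) → ℝ}
    (hw : tsupport w ⊆ Metric.closedBall 0 1) {h : ℝ} (hh : 0 < h)
    {x₀ x : EuclideanSpace ℝ (Fin d)} (hx : x ∉ Metric.closedBall x₀ h) :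
    w (h⁻¹ • (x - x₀)) = 0 := by
  refine image_eq_zero_of_notMem_tsupport fun hx' => hx ?_
  have := hw hx'
  rw [mem_closedBall_zero_iff, norm_smul, norm_inv, Real.norm_of_nonneg hh.le,
    inv_mul_le_iff₀ hh, mul_one] at this
  rwa [mem_closedBall_iff_norm]

/-- The `L²` norm of a scaled smooth function. -/
theorem exists_lintegral_sq_scaled_le {w : EuclideanSpace ℝ (Fin d) → ℝ}
    (hc : Continuous w) (hw : tsupport w ⊆ Metric.closedBall 0 1) :
    ∃ C : ENNReal, C ≠ ⊤ ∧ ∀ (U : Set (EuclideanSpace ℝ (Fin d)))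
      (x₀ : EuclideanSpace ℝ (Fin d)) (h c : ℝ), 0 < h →
      ∫⁻ x in U, ENNReal.ofReal (|c * w (h⁻¹ • (x - x₀))| ^ 2)
        ≤ C * ENNReal.ofReal (c ^ 2 * h ^ d) := by
  have hcs : HasCompactSupport w :=
    (isCompact_closedBall _ _).of_isClosed_subset (isClosed_tsupport w) hw
  obtain ⟨B, hB⟩ := hcs.exists_bound_of_continuous hc
  refine ⟨ENNReal.ofReal (B ^ 2) * volume (Metric.ball (0 : EuclideanSpace ℝ (Fin d)) 1),
    ENNReal.mul_ne_top ENNReal.ofReal_ne_top measure_ball_lt_top.ne, fun U x₀ h c hh => ?_⟩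
  calc ∫⁻ x in U, ENNReal.ofReal (|c * w (h⁻¹ • (x - x₀))| ^ 2)
      ≤ ∫⁻ x, ENNReal.ofReal (|c * w (h⁻¹ • (x - x₀))| ^ 2) := setLIntegral_le_lintegral _ _
    _ ≤ ∫⁻ x, (Metric.closedBall x₀ h).indicator
          (fun _ => ENNReal.ofReal (c ^ 2 * B ^ 2)) x := by
        refine lintegral_mono fun x => ?_
        by_cases hx : x ∈ Metric.closedBall x₀ h
        · rw [indicator_of_mem hx, abs_mul, mul_pow, sq_abs]
          have := hB (h⁻¹ • (x - x₀))
          rw [Real.norm_eq_abs] at this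
          gcongr
        · rw [eq_zero_of_notMem_closedBall hw hh hx]
          simp
    _ = _ := by
        rw [lintegral_indicator_const measurableSet_closedBall,
          volume_closedBall_euclidean x₀ hh.le, ENNReal.ofReal_mul (sq_nonneg c),
          ENNReal.ofReal_mul (sq_nonneg c)]
        ring

/-- The Lipschitz bound serves for nearby points and boundedness for distant ones. -/
theorem exists_sq_sub_le_min {w : EuclideanSpace ℝ (Fin d) → ℝ}
    (hw : ContDiff ℝ (⊤ : ℕ∞) w) (hcs : HasCompactSupport w) :
    ∃ K : ℝ, 0 ≤ K ∧ ∀ x y, |w x - w y| ^ 2 ≤ K * min (‖x - y‖ ^ 2) 1 := by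
  obtain ⟨B, hB⟩ := hcs.exists_bound_of_continuous hw.continuous
  obtain ⟨L, hL⟩ := ContDiff.lipschitzWith_of_hasCompactSupport hcs hw (by simp)
  refine ⟨max ((L : ℝ) ^ 2) ((2 * B) ^ 2), le_max_of_le_left (sq_nonneg _), fun x y => ?_⟩
  rw [mul_min_of_nonneg _ _ (le_max_of_le_left (sq_nonneg _)), le_min_iff, mul_one]
  constructor
  · have h1 : |w x - w y| ≤ L * ‖x - y‖ := by
      simpa [dist_eq_norm] using hL.dist_le_mul x y
    calc |w x - w y| ^ 2 ≤ (L * ‖x - y‖) ^ 2 := by gcongr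
      _ = (L : ℝ) ^ 2 * ‖x - y‖ ^ 2 := mul_pow _ _ _
      _ ≤ _ := by gcongr; exact le_max_left _ _
  · have h1 : |w x - w y| ≤ 2 * B := by
      have := norm_sub_le_of_le (hB x) (hB y)
      rw [Real.norm_eq_abs] at this
      linarith
    exact le_max_of_le_right (by gcongr)

/-- The Slobodeckij seminorm of a scaled smooth function. -/
theorem exists_slobodeckijSq_scaled_le [NeZero d] {s : ℝ} (hs : 0 < s) (hs1 : s < 1)
    {w : EuclideanSpace ℝ (Fin d) → ℝ} (hw : ContDiff ℝ (⊤ : ℕ∞) w)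
    (hsupp : tsupport w ⊆ Metric.closedBall 0 1) :
    ∃ C : ENNReal, C ≠ ⊤ ∧ ∀ (U : Set (EuclideanSpace ℝ (Fin d)))
      (x₀ : EuclideanSpace ℝ (Fin d)) (h c : ℝ), 0 < h →
      slobodeckijSq U s (fun x => c * w (h⁻¹ • (x - x₀)))
        ≤ C * ENNReal.ofReal (c ^ 2 * h ^ ((d : ℝ) - 2 * s)) := by
  have hcs : HasCompactSupport w :=
    (isCompact_closedBall _ _).of_isClosed_subset (isClosed_tsupport w) hsupp
  obtain ⟨K, hK0, hK⟩ := exists_sq_sub_le_min hw hcs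
  set I : ENNReal := ∫⁻ z, ENNReal.ofReal (slobodeckijProfile d s z) with hI
  set b : ENNReal := volume (Metric.ball (0 : EuclideanSpace ℝ (Fin d)) 1) with hb
  have hP : Measurable fun z => ENNReal.ofReal (slobodeckijProfile d s z) :=
    (measurable_slobodeckijProfile s).ennreal_ofReal
  refine ⟨ENNReal.ofReal K * (2 * b * I), ?_, fun U x₀ h c hh => ?_⟩
  · exact ENNReal.mul_ne_top ENNReal.ofReal_ne_top (ENNReal.mul_ne_top
      (ENNReal.mul_ne_top ENNReal.ofNat_ne_top measure_ball_lt_top.ne)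
      (integrable_slobodeckijProfile hs hs1).lintegral_lt_top.ne)
  set S : Set (EuclideanSpace ℝ (Fin d)) := Metric.closedBall x₀ h with hS
  have hSm : MeasurableSet S := measurableSet_closedBall
  set A : ENNReal := ENNReal.ofReal (c ^ 2 * K * (h ^ ((d : ℝ) + 2 * s))⁻¹) with hA
  set Q : EuclideanSpace ℝ (Fin d) → ENNReal :=
    fun z => ENNReal.ofReal (slobodeckijProfile d s (h⁻¹ • z)) with hQ
  have hQm : Measurable Q := hP.comp (by fun_prop)
  have hind : Measurable (S.indicator (fun _ => (1 : ENNReal))) :=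
    measurable_const.indicator hSm
  have hQI : ∫⁻ z, Q z = ENNReal.ofReal (h ^ d) * I := lintegral_comp_smul_euclidean hP hh
  -- The integrand vanishes unless x or y lies in the ball `S`. The double integral over ℝ^d is
  -- thereby dominated by two terms, each with one variable confined to `S` and the profile
  -- integrated in the other.
  have hpt : ∀ x y : EuclideanSpace ℝ (Fin d),
      ENNReal.ofReal (|c * w (h⁻¹ • (x - x₀)) - c * w (h⁻¹ • (y - x₀))| ^ 2
        / ‖x - y‖ ^ ((d : ℝ) + 2 * s))
      ≤ A * (S.indicator (fun _ => 1) x * Q (x - y) + S.indicator (fun _ => 1) y * Q (x - y)) := by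
    intro x y
    have key : ENNReal.ofReal (|c * w (h⁻¹ • (x - x₀)) - c * w (h⁻¹ • (y - x₀))| ^ 2
        / ‖x - y‖ ^ ((d : ℝ) + 2 * s)) ≤ A * Q (x - y) := by
      rw [hA, hQ, ← ENNReal.ofReal_mul (by positivity)]
      refine ENNReal.ofReal_le_ofReal ?_
      have h1 := hK (h⁻¹ • (x - x₀)) (h⁻¹ • (y - x₀))
      rw [← smul_sub, sub_sub_sub_cancel_right] at h1
      rw [← mul_sub, abs_mul, mul_pow, sq_abs, slobodeckijProfile, norm_smul, norm_inv,
        Real.norm_of_nonneg hh.le]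
      rw [norm_smul, norm_inv, Real.norm_of_nonneg hh.le] at h1
      rw [Real.mul_rpow (by positivity) (by positivity), Real.inv_rpow hh.le]
      have hne : h ^ ((d : ℝ) + 2 * s) ≠ 0 := (Real.rpow_pos_of_pos hh _).ne'
      calc _ ≤ c ^ 2 * (K * min ((h⁻¹ * ‖x - y‖) ^ 2) 1) / ‖x - y‖ ^ ((d : ℝ) + 2 * s) := by
            gcongr
        _ = _ := by
            rw [div_mul_eq_div_div, div_inv_eq_mul]
            field_simp
    by_cases hx : x ∈ S
    · refine key.trans (mul_le_mul_right ?_ _)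
      rw [indicator_of_mem hx, one_mul]
      exact le_self_add
    · by_cases hy : y ∈ S
      · refine key.trans (mul_le_mul_right ?_ _)
        rw [indicator_of_mem hy, one_mul]
        exact le_add_self
      · rw [eq_zero_of_notMem_closedBall hsupp hh hx, eq_zero_of_notMem_closedBall hsupp hh hy]
        simp
  have hQxy : Measurable fun p : EuclideanSpace ℝ (Fin d) × EuclideanSpace ℝ (Fin d) =>
      Q (p.1 - p.2) := hQm.comp (measurable_fst.sub measurable_snd)
  have h1 : ∫⁻ x, ∫⁻ y, S.indicator (fun _ => 1) x * Q (x - y)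
      = ENNReal.ofReal (h ^ d) * I * volume S := by
    have : ∀ x, ∫⁻ y, S.indicator (fun _ => 1) x * Q (x - y)
        = S.indicator (fun _ => 1) x * (ENNReal.ofReal (h ^ d) * I) := fun x => by
      have hm : Measurable fun y => Q (x - y) := hQm.comp (measurable_const_sub x)
      rw [lintegral_const_mul _ hm, lintegral_sub_left_eq_self Q x, hQI]
    simp_rw [this]
    rw [lintegral_mul_const _ hind, lintegral_indicator_const hSm, one_mul, mul_comm]
  have h2 : ∫⁻ x, ∫⁻ y, S.indicator (fun _ => 1) y * Q (x - y)
      = ENNReal.ofReal (h ^ d) * I * volume S := by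
    -- After the swap the inner variable is the one not confined to `S`, so translation invariance
    -- applies as in `h1`.
    rw [lintegral_lintegral_swap ((hind.comp measurable_snd).mul hQxy).aemeasurable]
    have : ∀ y, ∫⁻ x, S.indicator (fun _ => 1) y * Q (x - y)
        = S.indicator (fun _ => 1) y * (ENNReal.ofReal (h ^ d) * I) := fun y => by
      have hm : Measurable fun x => Q (x - y) := hQm.comp (measurable_sub_const y)
      rw [lintegral_const_mul _ hm, lintegral_sub_right_eq_self Q y, hQI]
    simp_rw [this]
    rw [lintegral_mul_const _ hind, lintegral_indicator_const hSm, one_mul, mul_comm]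
  have hm1 : Measurable fun p : EuclideanSpace ℝ (Fin d) × EuclideanSpace ℝ (Fin d) =>
      S.indicator (fun _ => 1) p.1 * Q (p.1 - p.2) := (hind.comp measurable_fst).mul hQxy
  calc slobodeckijSq U s (fun x => c * w (h⁻¹ • (x - x₀)))
      ≤ ∫⁻ x, ∫⁻ y, A * (S.indicator (fun _ => 1) x * Q (x - y)
          + S.indicator (fun _ => 1) y * Q (x - y)) :=
        (setLIntegral_le_lintegral _ _).trans (lintegral_mono fun x =>
          (setLIntegral_le_lintegral _ _).trans (lintegral_mono fun y => hpt x y))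
    _ = A * ((∫⁻ x, ∫⁻ y, S.indicator (fun _ => 1) x * Q (x - y))
          + ∫⁻ x, ∫⁻ y, S.indicator (fun _ => 1) y * Q (x - y)) := by
        rw [← lintegral_add_left hm1.lintegral_prod_right',
          ← lintegral_const_mul' _ _ ENNReal.ofReal_ne_top]
        refine lintegral_congr fun x => ?_
        have hx1 := hm1.comp (measurable_prodMk_left (x := x))
        rw [lintegral_const_mul' _ _ ENNReal.ofReal_ne_top]
        exact congrArg (A * ·) (lintegral_add_left hx1 _)
    _ = _ := by
        -- The power of h collects h^(-(d + 2s)) from the kernel, h^d from the rescaled profile and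
        -- h^d from the volume of `S`.
        have hpow : c ^ 2 * h ^ ((d : ℝ) - 2 * s)
            = c ^ 2 * (h ^ ((d : ℝ) + 2 * s))⁻¹ * (h ^ d * h ^ d) := by
          rw [← Real.rpow_natCast h d, ← Real.rpow_neg hh.le, mul_assoc, ← Real.rpow_add hh,
            ← Real.rpow_add hh]
          congr 2
          ring
        rw [h1, h2, hS, volume_closedBall_euclidean x₀ hh.le, ← hb, hpow, hA, mul_right_comm (c ^ 2) K,
          ENNReal.ofReal_mul (q := K) (by positivity),
          ENNReal.ofReal_mul (q := h ^ d * h ^ d) (by positivity),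
          ENNReal.ofReal_mul (q := h ^ d) (by positivity)]
        ring

end ScaledBounds

section Main

variable {d : ℕ}

/-- The scaling law for Sobolev norms: `‖ψ((· - x₀) / h)‖ ≤ C h^(d/2 - τ)` for bounded `h`. -/
theorem exists_sobolevNorm_scaled_le [NeZero d] {τ : ℝ} (hτ : 0 ≤ τ)
    {ψ : EuclideanSpace ℝ (Fin d) → ℝ} (hψ : ContDiff ℝ (⊤ : ℕ∞) ψ)
    (hsupp : tsupport ψ ⊆ Metric.closedBall 0 1) {R : ℝ} (hR : 0 < R) :
    ∃ C : ℝ, 0 ≤ C ∧ ∀ (U : Set (EuclideanSpace ℝ (Fin d))) (x₀ : EuclideanSpace ℝ (Fin d))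
      (h : ℝ) (u : EuclideanSpace ℝ (Fin d) → ℝ), IsOpen U → 0 < h → h ≤ R →
      EqOn u (fun x => ψ (h⁻¹ • (x - x₀))) U →
      sobolevNorm U τ u ≤ ENNReal.ofReal (C * h ^ ((d : ℝ) / 2 - τ)) := by
  set l := List.finRange d with hl
  have hsum : ∀ α : Fin d → ℕ, (l.map α).sum = ∑ i, α i := fun α => by
    rw [hl, ← List.ofFn_eq_map, List.sum_ofFn]
  have hw : ∀ α, ContDiff ℝ (⊤ : ℕ∞) (foldPartial α l ψ) := fun α => contDiff_foldPartial α l hψ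
  have hws : ∀ α, tsupport (foldPartial α l ψ) ⊆ Metric.closedBall 0 1 := fun α =>
    (tsupport_foldPartial_subset α l ψ).trans hsupp
  choose C hC hCle using fun α => exists_lintegral_sq_scaled_le (hw α).continuous (hws α)
  set m := ⌊τ⌋₊ with hm
  have hmτ : (m : ℝ) ≤ τ := Nat.floor_le hτ
  have hτm : τ - m < 1 := by linarith [Nat.lt_floor_add_one τ]
  -- For integer τ there is no seminorm to bound; the dummy constant 0 lets `choose` treat both
  -- cases at once.
  have hslob : ∀ α : Fin d → ℕ, ∃ C : ENNReal, C ≠ ⊤ ∧ (τ - m ≠ 0 →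
      ∀ (U : Set (EuclideanSpace ℝ (Fin d))) (x₀ : EuclideanSpace ℝ (Fin d)) (h c : ℝ), 0 < h →
      slobodeckijSq U (τ - m) (fun x => c * foldPartial α l ψ (h⁻¹ • (x - x₀)))
        ≤ C * ENNReal.ofReal (c ^ 2 * h ^ ((d : ℝ) - 2 * (τ - m)))) := fun α => by
    by_cases h0 : τ - m = 0
    · exact ⟨0, by simp, fun h => absurd h0 h⟩
    · obtain ⟨C, hC, h⟩ := exists_slobodeckijSq_scaled_le
        (lt_of_le_of_ne (by linarith) (Ne.symm h0)) hτm (hw α) (hws α)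
      exact ⟨C, hC, fun _ => h⟩
  choose C' hC' hCle' using hslob
  -- A term of order n scales like h^(d - 2n) = h^(2(τ - n)) h^(d - 2τ), and h ≤ R bounds the first
  -- factor. The seminorm terms scale exactly like h^(d - 2τ) and need no such factor.
  set S : ENNReal := (∑ n ∈ Finset.range (m + 1),
      ∑ α ∈ Finset.piAntidiag (Finset.univ : Finset (Fin d)) n,
        C α * ENNReal.ofReal (R ^ (2 * (τ - n)))) +
      ∑ α ∈ Finset.piAntidiag (Finset.univ : Finset (Fin d)) m, C' α with hS
  have hStop : S ≠ ⊤ := by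
    refine ENNReal.add_ne_top.2 ⟨?_, ENNReal.sum_ne_top.2 fun α _ => hC' α⟩
    exact ENNReal.sum_ne_top.2 fun n _ => ENNReal.sum_ne_top.2 fun α _ =>
      ENNReal.mul_ne_top (hC α) ENNReal.ofReal_ne_top
  refine ⟨(S ^ (1 / 2 : ℝ)).toReal, ENNReal.toReal_nonneg, fun U x₀ h u hU hh hhR hu => ?_⟩
  set f : EuclideanSpace ℝ (Fin d) → ℝ := fun x => 1 * ψ (h⁻¹ • (x - x₀)) with hf
  have hfs : ContDiff ℝ (⊤ : ℕ∞) f := by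
    have : ContDiff ℝ (⊤ : ℕ∞) fun x : EuclideanSpace ℝ (Fin d) => h⁻¹ • (x - x₀) :=
      (contDiff_id.sub contDiff_const).const_smul h⁻¹
    exact contDiff_const.mul (hψ.comp this)
  have huf : EqOn u f U := fun x hx => by simp only [hu hx, hf, one_mul]
  have hD : ∀ α, foldPartial α l f
      = fun x => (h⁻¹) ^ (∑ i, α i) * foldPartial α l ψ (h⁻¹ • (x - x₀)) := fun α => by
    rw [hf, foldPartial_scaled α l hψ, hsum, one_mul]
  have hsq : sobolevSqOf U τ (fun α => foldPartial α l f)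
      ≤ S * ENNReal.ofReal (h ^ ((d : ℝ) - 2 * τ)) := by
    rw [hS, add_mul, sobolevSqOf]
    refine add_le_add ?_ ?_
    · rw [Finset.sum_mul]
      refine Finset.sum_le_sum fun n hn => ?_
      rw [Finset.sum_mul]
      refine Finset.sum_le_sum fun α hα => ?_
      have hαn : ∑ i, α i = n := (Finset.mem_piAntidiag.1 hα).1
      have hnm : (n : ℝ) ≤ m := by exact_mod_cast Nat.lt_succ_iff.1 (Finset.mem_range.1 hn)
      rw [hD, hαn, mul_assoc, ← ENNReal.ofReal_mul (by positivity)]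
      refine (hCle α U x₀ h _ hh).trans ?_
      refine mul_le_mul_right (ENNReal.ofReal_le_ofReal ?_) _
      calc ((h⁻¹) ^ n) ^ 2 * h ^ d = h ^ (2 * (τ - n)) * h ^ ((d : ℝ) - 2 * τ) := by
            rw [← Real.rpow_add hh, ← pow_mul, inv_pow, ← Real.rpow_natCast h d,
              ← Real.rpow_natCast h (n * 2), ← Real.rpow_neg hh.le, ← Real.rpow_add hh]
            congr 1
            push_cast
            ring
        _ ≤ _ := by
            gcongr
            linarith
    · split_ifs with h0
      · exact zero_le
      · rw [Finset.sum_mul]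
        refine Finset.sum_le_sum fun α hα => ?_
        have hαn : ∑ i, α i = m := (Finset.mem_piAntidiag.1 hα).1
        rw [hD, hαn]
        refine (hCle' α h0 U x₀ h _ hh).trans (le_of_eq ?_)
        congr 2
        rw [← pow_mul, inv_pow, ← Real.rpow_natCast h (m * 2), ← Real.rpow_neg hh.le,
          ← Real.rpow_add hh]
        congr 1
        push_cast
        ring
  calc sobolevNorm U τ u
      ≤ (S * ENNReal.ofReal (h ^ ((d : ℝ) - 2 * τ))) ^ (1 / 2 : ℝ) := by
        refine ENNReal.rpow_le_rpow ?_ (by norm_num)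
        exact (iInf₂_le (fun α => foldPartial α l f)
          (fun α _ => hasWeakDeriv_foldPartial hU α hfs huf)).trans hsq
    _ = _ := by
        rw [ENNReal.mul_rpow_of_nonneg _ _ (by norm_num),
          ENNReal.ofReal_mul ENNReal.toReal_nonneg,
          ENNReal.ofReal_toReal (ENNReal.rpow_ne_top_of_nonneg (by norm_num) hStop),
          ENNReal.ofReal_rpow_of_nonneg (by positivity) (by norm_num), ← Real.rpow_mul hh.le]
        congr 3
        ring

/-! ### The interior cone condition -/

/-- There is no unit vector in dimension zero. The polar coordinates behind the Slobodeckij bound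
need d ≥ 1. -/
theorem InteriorConeCondition.neZero {Ω : Set (EuclideanSpace ℝ (Fin d))}
    (hΩ : InteriorConeCondition Ω) (hne : Ω.Nonempty) : NeZero d := by
  obtain ⟨θ, _, r, _, hc⟩ := hΩ
  obtain ⟨x, hx⟩ := hne
  obtain ⟨ξ, hξ, _⟩ := hc x hx
  refine ⟨fun hd => ?_⟩
  subst hd
  rw [Subsingleton.elim ξ 0, norm_zero] at hξ
  exact zero_ne_one hξ

/-- Under the interior cone condition, balls centred in `Ω` meet `Ω` in positive measure. -/
theorem InteriorConeCondition.volume_inter_ball_pos {Ω : Set (EuclideanSpace ℝ (Fin d))}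
    (hΩ : InteriorConeCondition Ω) {x : EuclideanSpace ℝ (Fin d)} (hx : x ∈ Ω) {δ : ℝ}
    (hδ : 0 < δ) : 0 < volume (Ω ∩ Metric.ball x δ) := by
  obtain ⟨θ, hθ, r, hr, hc⟩ := hΩ
  obtain ⟨ξ, hξ, hsub⟩ := hc x hx
  set c := Real.cos θ with hcdef
  have hc0 : 0 < c := Real.cos_pos_of_mem_Ioo ⟨by linarith [hθ.1, Real.pi_pos], hθ.2⟩
  have hc1 : c < 1 := by
    have := Real.cos_lt_cos_of_nonneg_of_le_pi_div_two le_rfl hθ.2.le hθ.1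
    rwa [Real.cos_zero] at this
  set t := min r δ / 2 with ht
  have ht0 : 0 < t := half_pos (lt_min hr hδ)
  have htr : 2 * t ≤ r := by rw [ht]; linarith [min_le_left r δ]
  have htδ : 2 * t ≤ δ := by rw [ht]; linarith [min_le_right r δ]
  -- Each point x + w of the ball of radius ρ about x + tξ has ⟨w, ξ⟩ ≥ t - ρ and ‖w‖ ≤ t + ρ. This
  -- ρ gives t - ρ - c(t + ρ) = t(1 - c)²/2 ≥ 0, the angle condition, and ρ < t keeps ‖w‖ below 2t ≤
  -- min(r, δ).
  set ρ := t * (1 - c) / 2 with hρ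
  have hρ0 : 0 < ρ := by have := sub_pos.2 hc1; positivity
  have hρt : ρ < t := by rw [hρ]; nlinarith
  refine (Metric.measure_ball_pos volume (x + t • ξ) hρ0).trans_le (measure_mono fun z hz => ?_)
  set w := z - x with hw
  have he : ‖w - t • ξ‖ < ρ := by
    rw [mem_ball_iff_norm] at hz
    rwa [hw, sub_sub]
  have htξ : ‖t • ξ‖ = t := by rw [norm_smul, hξ, mul_one, Real.norm_of_nonneg ht0.le]
  have hup : ‖w‖ ≤ t + ρ := by
    have := norm_le_norm_add_norm_sub' w (t • ξ)
    linarith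
  have hinner : t - ρ ≤ inner ℝ w ξ := by
    have h1 : inner ℝ w ξ = t + inner ℝ (w - t • ξ) ξ := by
      rw [inner_sub_left w, inner_smul_left, real_inner_self_eq_norm_sq, hξ]
      simp
    have h2 := (abs_le.1 (abs_real_inner_le_norm (w - t • ξ) ξ)).1
    rw [hξ, mul_one] at h2
    linarith
  have hw0 : 0 < ‖w‖ := by
    rw [norm_pos_iff]
    intro h0
    rw [h0, inner_zero_left] at hinner
    linarith
  refine ⟨hsub ⟨‖w‖, ‖w‖⁻¹ • w, ⟨hw0.le, by linarith⟩, ?_, ?_, ?_⟩, ?_⟩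
  · rw [norm_smul, norm_inv, norm_norm, inv_mul_cancel₀ hw0.ne']
  · rw [inner_smul_left, RCLike.conj_to_real, ← div_eq_inv_mul, le_div_iff₀ hw0]
    calc c * ‖w‖ ≤ c * (t + ρ) := by gcongr
      _ ≤ t - ρ := by rw [hρ]; nlinarith [mul_nonneg ht0.le (sq_nonneg (1 - c))]
      _ ≤ _ := hinner
  · rw [smul_inv_smul₀ hw0.ne', hw, add_sub_cancel]
  · rw [mem_ball_iff_norm]
    linarith

/-! ### The lower bound for the approximation error -/

/-- The interpolant of a function vanishing on `X` is zero. -/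
theorem kernelProj_eq_zero {Ω : Type*} {k : Ω → Ω → ℝ} {H : Type*} [NormedAddCommGroup H]
    [InnerProductSpace ℝ H] [RKHS ℝ H Ω ℝ] (hH : IsNativeSpace k H) {X : Finset Ω} {f : H}
    (hf : ∀ x ∈ X, f x = 0) : kernelProj k X f = 0 := by
  refine ((kernelSpan k H X).starProjection_apply_eq_zero_iff).2 ?_
  refine (Submodule.mem_orthogonal' _ _).2 fun g hg => ?_
  induction hg using Submodule.span_induction with
  | mem g hg =>
    obtain ⟨x, hx, hg⟩ := hg
    obtain ⟨g', hg', hin⟩ := hH x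
    -- Elements of the native space are determined by their values, so the generator is the
    -- representer of evaluation at x.
    have : g = g' := DFunLike.coe_injective (funext fun y => (hg y).trans (hg' y).symm)
    rw [this, hin, hf x hx]
  | zero => exact inner_zero_right _
  | add a b _ _ ha hb => rw [inner_add_right, ha, hb, add_zero]
  | smul c a _ ha => rw [inner_smul_right, ha, mul_zero]

/-- The L^∞ norm is an essential supremum, so the value 1 at a single point would not suffice: it
must be taken on a set of positive measure. -/
theorem one_le_eLpNorm_top_of_eqOn_one {Ω : Set (EuclideanSpace ℝ (Fin d))}
    (hm : MeasurableSet Ω) {A : Set (EuclideanSpace ℝ (Fin d))} (hA : 0 < volume (Ω ∩ A))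
    {f : Ω → ℝ} (hf : ∀ x : Ω, (x : EuclideanSpace ℝ (Fin d)) ∈ A → f x = 1) :
    1 ≤ eLpNorm f ⊤ (Measure.comap Subtype.val volume) := by
  by_contra! hlt
  have hae : ∀ᵐ x ∂(Measure.comap (Subtype.val : Ω → _) volume),
      ‖f x‖ₑ ≤ eLpNorm f ⊤ (Measure.comap Subtype.val volume) := by
    rw [eLpNorm_exponent_top]
    exact enorm_ae_le_eLpNormEssSup f _
  have h0 : (Measure.comap (Subtype.val : Ω → _) volume) (Subtype.val ⁻¹' A) = 0 := by
    refine measure_mono_null ?_ (ae_iff.1 hae)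
    intro x hx hle
    have := hle.trans_lt hlt
    rw [hf x hx] at this
    simp at this
  rw [(MeasurableEmbedding.subtype_coe hm).comap_apply, Subtype.image_preimage_coe] at h0
  exact hA.ne' h0

end Main

/-! ### The bump function argument -/

theorem mainTheorem8 {d : ℕ} (Ω : Set (EuclideanSpace ℝ (Fin d))) (hne : Ω.Nonempty)
    (hcpt : IsCompact Ω) (hcone : InteriorConeCondition Ω)
    (k : Ω → Ω → ℝ) (hpd : IsStrictlyPosDefKernel k) (htrans : IsTranslationInvariant k)
    (H : Type*) [NormedAddCommGroup H] [InnerProductSpace ℝ H] [CompleteSpace H]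
    [RKHS ℝ H Ω ℝ] (hH : IsNativeSpace k H)
    (τ : ℝ) (hτ : HasFiniteSmoothness Ω H τ) :
    ∃ M > (0 : ℝ), ∀ ε > (0 : ℝ), ∀ X : Finset Ω, X.Nonempty →
      (∀ f : H, eLpNorm (fun x : Ω => f x - kernelProj k X f x) ⊤
          (Measure.comap Subtype.val volume)
        ≤ ENNReal.ofReal (ε * ‖f‖)) →
      fillDistance Ω X ≤ M * ε ^ (1 / (τ - (d : ℝ) / 2)) := by
  have := hcone.neZero hne
  have hp : 0 < τ - (d : ℝ) / 2 := sub_pos.2 hτ.lt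
  have hτ0 : 0 ≤ τ := by linarith [show (0 : ℝ) ≤ (d : ℝ) / 2 by positivity]
  obtain ⟨c, hc, _, _, hnorm⟩ := hτ.norm_equiv
  -- ψ is 1 on the ball of radius 1/2 and supported in the closed unit ball.
  let ψ : ContDiffBump (0 : EuclideanSpace ℝ (Fin d)) := ⟨1 / 2, 1, by norm_num, by norm_num⟩
  obtain ⟨C, hC, hbound⟩ := exists_sobolevNorm_scaled_le hτ0 (ψ := ψ) ψ.contDiff
    ψ.tsupport_eq.subset (R := Metric.diam Ω + 1) (by positivity)
  -- `C` may be zero; `C + 1` keeps the constant positive.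
  set M : ℝ := ((C + 1) / c) ^ (1 / (τ - (d : ℝ) / 2)) with hM
  have hM0 : 0 < M := by positivity
  refine ⟨2 * M, by positivity, fun ε hε X hX happrox => ?_⟩
  rcases le_or_gt (fillDistance Ω X) 0 with hfd | hfd
  · exact hfd.trans (by positivity)
  -- Halving gives a point strictly farther than h from X without asking whether the supremum is
  -- attained; it accounts for the factor 2 in the final constant.
  set h := fillDistance Ω X / 2 with hh
  have hh0 : 0 < h := half_pos hfd
  have : Nonempty Ω := hne.to_subtype
  obtain ⟨x₀, hx₀⟩ := exists_lt_of_lt_ciSup (show h < fillDistance Ω X from half_lt_self hfd)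
  have hfar : ∀ y ∈ X, h < ‖(x₀ : EuclideanSpace ℝ (Fin d)) - (y : EuclideanSpace ℝ (Fin d))‖ :=
    fun y hy => hx₀.trans_le (ciInf_le (Finite.bddBelow_range _) (⟨y, hy⟩ : X))
  have hhR : h ≤ Metric.diam Ω + 1 := by
    obtain ⟨y, hy⟩ := hX
    have := Metric.dist_le_diam_of_mem hcpt.isBounded x₀.2 y.2
    rw [dist_eq_norm] at this
    linarith [hfar y hy]
  let F : EuclideanSpace ℝ (Fin d) → ℝ := fun x => ψ (h⁻¹ • (x - x₀))
  let f : Ω → ℝ := fun x => F x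
  have hfcont : Continuous f := by
    have : Continuous F := ψ.continuous.comp (by fun_prop)
    exact this.comp continuous_subtype_val
  have hsob : sobolevNormOn Ω τ f ≤ ENNReal.ofReal (C * h ^ ((d : ℝ) / 2 - τ)) := by
    refine hbound (interior Ω) x₀ h _ isOpen_interior hh0 hhR fun x hx => ?_
    exact Subtype.val_injective.extend_apply f 0 (⟨x, interior_subset hx⟩ : Ω)
  obtain ⟨g, hg⟩ := (hτ.mem_iff f).2 ⟨hfcont, hsob.trans_lt ENNReal.ofReal_lt_top⟩
  have hgnorm : c * ‖g‖ ≤ C * h ^ ((d : ℝ) / 2 - τ) := by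
    have := (hnorm g).1
    rw [hg] at this
    exact (ENNReal.ofReal_le_ofReal_iff (by positivity)).1 (this.trans hsob)
  have hproj : kernelProj k X g = 0 := by
    refine kernelProj_eq_zero hH fun y hy => ?_
    rw [hg]
    refine ψ.zero_of_le_dist ?_
    rw [dist_zero_right, norm_smul, norm_inv, Real.norm_of_nonneg hh0.le, norm_sub_rev,
      le_inv_mul_iff₀ hh0]
    exact (mul_one h).le.trans (hfar y hy).le
  have hone : 1 ≤ ε * ‖g‖ := by
    have h1 : 1 ≤ eLpNorm f ⊤ (Measure.comap Subtype.val volume) := by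
      refine one_le_eLpNorm_top_of_eqOn_one hcpt.measurableSet
        (hcone.volume_inter_ball_pos x₀.2 (half_pos hh0)) fun x hx => ?_
      refine ψ.one_of_mem_closedBall ?_
      rw [mem_ball_iff_norm] at hx
      rw [mem_closedBall_zero_iff, norm_smul, norm_inv, Real.norm_of_nonneg hh0.le,
        inv_mul_le_iff₀ hh0]
      change _ ≤ h * (1 / 2)
      linarith
    have h2 := happrox g
    rw [hproj, show (fun x : Ω => g x - (0 : H) x) = f by
      funext x; rw [hg]; simp] at h2
    have h3 := h1.trans h2
    rwa [← ENNReal.ofReal_one, ENNReal.ofReal_le_ofReal_iff (by positivity)] at h3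
  -- This combines 1 ≤ ε‖g‖ with c‖g‖ ≤ C h^(d/2 - τ), eliminating ‖g‖.
  have hpow : h ^ (τ - (d : ℝ) / 2) ≤ (C + 1) / c * ε := by
    have hn : h ^ ((d : ℝ) / 2 - τ) = (h ^ (τ - (d : ℝ) / 2))⁻¹ := by
      rw [← Real.rpow_neg hh0.le, neg_sub]
    rw [hn, ← div_eq_mul_inv, le_div_iff₀ (by positivity)] at hgnorm
    set P := h ^ (τ - (d : ℝ) / 2) with hP
    have hP0 : 0 < P := by positivity
    rw [div_mul_eq_mul_div, le_div_iff₀ hc]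
    calc P * c = c * P * 1 := by ring
      _ ≤ c * P * (ε * ‖g‖) := by gcongr
      _ = c * ‖g‖ * P * ε := by ring
      _ ≤ (C + 1) * ε := by gcongr; linarith
  have hfin : h ≤ M * ε ^ (1 / (τ - (d : ℝ) / 2)) := by
    rw [hM, ← Real.mul_rpow (by positivity) hε.le]
    calc h = (h ^ (τ - (d : ℝ) / 2)) ^ (1 / (τ - (d : ℝ) / 2)) := by
          rw [← Real.rpow_mul hh0.le, mul_one_div_cancel hp.ne', Real.rpow_one]
      _ ≤ _ := by gcongr
  calc fillDistance Ω X = 2 * h := by rw [hh]; ring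
    _ ≤ 2 * (M * ε ^ (1 / (τ - (d : ℝ) / 2))) := by gcongr
    _ = _ := by ring
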